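/- Write permutations in one-line notation. For $q\in S_k$ and $p=p_1p_2\cdots p_n\in S_n$, let $f_q(p)$ be the number of occurrences of $q$ in $p$ as a pattern, that is, the number of index sequences $1\le i_1<i_2<\cdots<i_k\le n$ such that, for all $a,b\in\{1,\dots,k\}$, $q_a<q_b$ if and only if $p_{i_a}<p_{i_b}$. Let $\mathrm{Av}_n(123)$ be the set of all $p\in S_n$ with no occurrence of the pattern $123$, and put $f_q(\mathrm{Av}_n(123))=\sum_{p\in \mathrm{Av}_n(123)} f_q(p)$. Proposition. Let $k$ be a positive integer, and let $q$ be any permutation in $S_k$ other than the decreasing permutation $k\cdots 321$. Then there is an $N$ such that for all $n\ge N$ $$f_{k\cdots 321}(\mathrm{Av}_n(123)) > f_q(\mathrm{Av}_n(123)).$$ -/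

import Mathlib

/-- `f` selects the positions of an occurrence of the pattern `q` in the permutation `p`:
the positions are increasing, and the entries of `p` there are in the same relative order
as the entries of `q`. -/
def IsOccurrence {k n : ℕ} (q : Equiv.Perm (Fin k)) (p : Equiv.Perm (Fin n))
    (f : Fin k → Fin n) : Prop :=
  (∀ a b, a < b → f a < f b) ∧ ∀ a b, q a < q b ↔ p (f a) < p (f b)

instance {k n : ℕ} (q : Equiv.Perm (Fin k)) (p : Equiv.Perm (Fin n)) :
    DecidablePred (IsOccurrence q p) :=
  fun f => inferInstanceAs (Decidable
    ((∀ a b, a < b → f a < f b) ∧ ∀ a b, q a < q b ↔ p (f a) < p (f b)))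

/-- The number of occurrences of `q` in `p` as a pattern. -/
def patternCount {k n : ℕ} (q : Equiv.Perm (Fin k)) (p : Equiv.Perm (Fin n)) : ℕ :=
  (Finset.univ.filter (IsOccurrence q p)).card

/-- `p` contains `q` as a pattern. -/
def ContainsPattern {k n : ℕ} (q : Equiv.Perm (Fin k)) (p : Equiv.Perm (Fin n)) : Prop :=
  ∃ f : Fin k → Fin n, IsOccurrence q p f

instance {k n : ℕ} (q : Equiv.Perm (Fin k)) (p : Equiv.Perm (Fin n)) :
    Decidable (ContainsPattern q p) :=
  inferInstanceAs (Decidable (∃ f : Fin k → Fin n, IsOccurrence q p f))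

/-- The permutations of length `n` that avoid the pattern `r`. -/
def avoiders {m : ℕ} (n : ℕ) (r : Equiv.Perm (Fin m)) : Finset (Equiv.Perm (Fin n)) :=
  Finset.univ.filter (fun p => ¬ ContainsPattern r p)

/-- The total number of occurrences of `q` in the permutations of the finite set `C`. -/
def totalCount {k n : ℕ} (q : Equiv.Perm (Fin k)) (C : Finset (Equiv.Perm (Fin n))) : ℕ :=
  ∑ p ∈ C, patternCount q p

/-- The increasing pattern `123`. -/
def pattern123 : Equiv.Perm (Fin 3) := 1

/-- The decreasing permutation `k ⋯ 21`, sending `i` to `k - 1 - i` (indices from `0`). -/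
def decreasingPerm (k : ℕ) : Equiv.Perm (Fin k) := Fin.revPerm

/-! An occurrence of any `q` other than the decreasing pattern contains a noninversion, and one
noninversion lies in at most `k ^ 2 * n ^ (k - 2)` selections of `k` positions. So it suffices that
a `123`-avoider has on average o(n²) noninversions: then almost all of the `n.choose k` selections
are decreasing.

The average is bounded through the generating tree that inserts a new maximum. With the initial
decreasing run as label, a node `s` has children `1, …, s + 1`, and an insertion creates at most as
many noninversions as the child's label (`card_noninversions_insertMax_le_initialRun`). The node has
`ballot r s` descendants `r` levels down. Averaged over paths from the root, the sum of squared
labels is at most 3n² (`sum_ballot_mul_le`); AM-GM with a free parameter `L` turns this into a bound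
on the sum of labels (`sum_noninversions_le`). -/

/-! ### Ballot numbers and squared labels -/

/-- The ballot number `(s + 1) (2 r + s)! / (r! (r + s + 1)!)`. -/
def ballot (r s : ℕ) : ℚ :=
  (s + 1) * (2 * r + s).factorial / (r.factorial * (r + s + 1).factorial)

theorem ballot_nonneg (r s : ℕ) : 0 ≤ ballot r s := by
  unfold ballot; positivity

theorem ballot_zero (s : ℕ) : ballot 0 s = 1 := by
  have : ((s.factorial : ℕ) : ℚ) ≠ 0 := by positivity
  simp only [ballot, Nat.factorial_succ, mul_zero, zero_add, Nat.factorial_zero]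
  push_cast
  field_simp

/-- The three ballot numbers in the ballot recurrence are proportional to explicit polynomials. -/
theorem ballot_common_factor (r s : ℕ) : ∃ c : ℚ, 0 ≤ c ∧
    ballot (r + 1) (s + 1) = c * ((s + 2) * (2 * r + s + 3)) ∧
    ballot (r + 1) s = c * ((s + 1) * (r + s + 3)) ∧
    ballot r (s + 2) = c * ((s + 3) * (r + 1)) := by
  refine ⟨(2 * r + s + 2).factorial / ((r + 1).factorial * (r + s + 3).factorial),
    by positivity, ?_, ?_, ?_⟩
  · rw [ballot, show 2 * (r + 1) + (s + 1) = 2 * r + s + 2 + 1 by ring,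
      show r + 1 + (s + 1) + 1 = r + s + 3 by ring, Nat.factorial_succ (2 * r + s + 2)]
    push_cast
    ring
  · rw [ballot, show 2 * (r + 1) + s = 2 * r + s + 2 by ring,
      show r + 1 + s + 1 = r + s + 2 by ring, Nat.factorial_succ (r + s + 2)]
    have : (((r + s + 2).factorial : ℕ) : ℚ) ≠ 0 := by positivity
    push_cast
    field_simp
    ring
  · rw [ballot, show 2 * r + (s + 2) = 2 * r + s + 2 by ring,
      show r + (s + 2) + 1 = r + s + 3 by ring, Nat.factorial_succ r]
    have : (((r).factorial : ℕ) : ℚ) ≠ 0 := by positivity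
    push_cast
    field_simp
    ring

theorem ballot_succ_zero (r : ℕ) : ballot (r + 1) 0 = ballot r 1 := by
  rw [ballot, ballot, show 2 * (r + 1) + 0 = 2 * r + 1 + 1 by ring, show r + 1 + 0 + 1 = r + 2 by ring,
      Nat.factorial_succ (2 * r + 1), Nat.factorial_succ r]
  have : (((r).factorial : ℕ) : ℚ) ≠ 0 := by positivity
  push_cast
  field_simp
  ring

/-- The descendant count of a node is the sum of those of its children. -/
theorem sum_ballot (r s : ℕ) :
    ∑ t ∈ Finset.range (s + 1), ballot r (t + 1) = ballot (r + 1) s := by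
  induction s with
  | zero => simp [ballot_succ_zero]
  | succ s ih =>
    obtain ⟨c, -, h1, h2, h3⟩ := ballot_common_factor r s
    rw [Finset.sum_range_succ, ih, h1, h2, h3]
    ring

/-- A bound for the mean of the sum of squares of the labels met in `r` further steps of the
generating tree, starting at label `s`. -/
def squareBound (r s : ℕ) : ℚ := r * (3 * r + s ^ 2 + 2 * s)

/-- One level of the tree: each child contributes its squared label and its own bound, weighted by
its number of descendants. -/
theorem sum_ballot_mul_le (r s : ℕ) :
    ∑ t ∈ Finset.range (s + 1), ballot r (t + 1) * ((t + 1 : ℕ) ^ 2 + squareBound r (t + 1)) ≤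
      ballot (r + 1) s * squareBound (r + 1) s := by
  induction s with
  | zero =>
    simp only [zero_add, Finset.sum_range_one, ballot_succ_zero]
    refine mul_le_mul_of_nonneg_left ?_ (ballot_nonneg _ _)
    simp only [squareBound]
    push_cast
    have : (0 : ℚ) ≤ r := by positivity
    nlinarith
  | succ s ih =>
    obtain ⟨c, hc, h1, h2, h3⟩ := ballot_common_factor r s
    rw [Finset.sum_range_succ]
    refine (add_le_add_left ih _).trans ?_
    rw [h1, h2, h3, ← sub_nonneg]
    -- This is exactly the slack in the induction step.
    have key : 0 ≤ c * ((r + 1) * ((s + 3) * (2 * (s + 1) ^ 2 + (s + 1) + 2) + 6 * r)) := by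
      positivity
    refine key.trans_eq ?_
    simp only [squareBound]
    push_cast
    ring

/-! ### Insertion of a maximum and the initial run -/

/-- Insert a new largest entry at position `i` of the permutation `p`. -/
def insertMax {n : ℕ} (p : Equiv.Perm (Fin n)) (i : Fin (n + 1)) : Equiv.Perm (Fin (n + 1)) :=
  ((finSuccEquiv' i).trans (Equiv.optionCongr p)).trans (finSuccEquiv' (Fin.last n)).symm

theorem insertMax_self {n : ℕ} (p : Equiv.Perm (Fin n)) (i : Fin (n + 1)) :
    insertMax p i i = Fin.last n := by
  simp [insertMax]

theorem insertMax_succAbove {n : ℕ} (p : Equiv.Perm (Fin n)) (i : Fin (n + 1)) (j : Fin n) :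
    insertMax p i (i.succAbove j) = (p j).castSucc := by
  simp [insertMax]

theorem insertMax_bijective (n : ℕ) :
    Function.Bijective (fun x : Equiv.Perm (Fin n) × Fin (n + 1) => insertMax x.1 x.2) := by
  rw [Fintype.bijective_iff_injective_and_card]
  constructor
  · rintro ⟨p, i⟩ ⟨p', i'⟩ h
    have h : insertMax p i = insertMax p' i' := h
    have hi : i = i' := by
      apply (insertMax p' i').injective
      rw [← h, insertMax_self, h, insertMax_self]
    subst hi
    have hp : p = p' := by
      ext j
      have := congrArg (fun σ => σ (i.succAbove j)) h
      simp only [insertMax_succAbove, Fin.castSucc_inj] at this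
      rw [this]
    rw [hp]
  · simp [Fintype.card_perm, Nat.factorial_succ, mul_comm]

/-- `p` has no increasing subsequence of length three. -/
def NoIncreasingTriple {n : ℕ} (p : Equiv.Perm (Fin n)) : Prop :=
  ∀ a b c, a < b → b < c → p a < p b → ¬ p b < p c

theorem mem_avoiders_pattern123 {n : ℕ} (p : Equiv.Perm (Fin n)) :
    p ∈ avoiders n pattern123 ↔ NoIncreasingTriple p := by
  simp only [avoiders, Finset.mem_filter, Finset.mem_univ, true_and, ContainsPattern, IsOccurrence,
    pattern123, Equiv.Perm.coe_one, id_eq, NoIncreasingTriple, not_exists]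
  constructor
  · intro h a b c hab hbc h1 h2
    refine h ![a, b, c] ⟨?_, ?_⟩
    · intro x y hxy
      fin_cases x <;> fin_cases y <;> simp_all
      exact hab.trans hbc
    · intro x y
      fin_cases x <;> fin_cases y <;> simp_all [le_of_lt]
      · exact h1.trans h2
      · exact (h1.trans h2).le
  · rintro h f ⟨hf, hp⟩
    exact h (f 0) (f 1) (f 2) (hf _ _ (by decide)) (hf _ _ (by decide))
      ((hp 0 1).1 (by decide)) ((hp 1 2).1 (by decide))

/-- The first `i` entries of `p` are decreasing. -/
def DecreasingPrefix {n : ℕ} (p : Equiv.Perm (Fin n)) (i : ℕ) : Prop :=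
  ∀ a b : Fin n, a < b → (b : ℕ) < i → p b < p a

theorem DecreasingPrefix.mono {n : ℕ} {p : Equiv.Perm (Fin n)} {i j : ℕ}
    (h : DecreasingPrefix p j) (hij : i ≤ j) : DecreasingPrefix p i :=
  fun a b hab hb => h a b hab (hb.trans_le hij)

open Classical in
/-- The length of the initial decreasing run of `p`. -/
noncomputable def initialRun {n : ℕ} (p : Equiv.Perm (Fin n)) : ℕ :=
  Nat.findGreatest (DecreasingPrefix p) n

theorem initialRun_le {n : ℕ} (p : Equiv.Perm (Fin n)) : initialRun p ≤ n :=
  by classical exact Nat.findGreatest_le n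

theorem le_initialRun_iff {n : ℕ} (p : Equiv.Perm (Fin n)) {i : ℕ} (hi : i ≤ n) :
    i ≤ initialRun p ↔ DecreasingPrefix p i := by
  classical
  constructor
  · intro h
    have h0 : DecreasingPrefix p 0 := fun a b _ hb => absurd hb (Nat.not_lt_zero _)
    have : DecreasingPrefix p (initialRun p) :=
      Nat.findGreatest_spec (P := DecreasingPrefix p) (Nat.zero_le n) h0
    exact this.mono h
  · intro h
    exact Nat.le_findGreatest hi h

theorem initialRun_eq {n : ℕ} (p : Equiv.Perm (Fin n)) {i : ℕ} (hi : i ≤ n)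
    (h : DecreasingPrefix p i) (h' : i < n → ¬ DecreasingPrefix p (i + 1)) :
    initialRun p = i := by
  refine le_antisymm ?_ ((le_initialRun_iff p hi).2 h)
  by_contra! hlt
  have hn : i < n := hlt.trans_le (initialRun_le p)
  exact h' hn ((le_initialRun_iff p hn).1 hlt)

/-- The new maximum can only be the last entry of a `123`, which needs an ascent before it. -/
theorem noIncreasingTriple_insertMax {n : ℕ} (p : Equiv.Perm (Fin n)) (i : Fin (n + 1)) :
    NoIncreasingTriple (insertMax p i) ↔ NoIncreasingTriple p ∧ (i : ℕ) ≤ initialRun p := by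
  rw [le_initialRun_iff p (Nat.lt_succ_iff.1 i.2)]
  constructor
  · intro h
    constructor
    · intro a b c hab hbc h1 h2
      refine h (i.succAbove a) (i.succAbove b) (i.succAbove c) ?_ ?_ ?_ ?_ <;>
        simpa [insertMax_succAbove]
    · intro a b hab hb
      by_contra! hle
      have hlt : p a < p b := lt_of_le_of_ne hle (p.injective.ne hab.ne)
      refine h (i.succAbove a) (i.succAbove b) i ?_ ?_ ?_ ?_
      · simpa
      · rw [Fin.succAbove_of_castSucc_lt _ _ (by simpa [Fin.lt_def] using hb)]
        simpa [Fin.lt_def] using hb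
      · simpa [insertMax_succAbove]
      · simp [insertMax_self, insertMax_succAbove, Fin.castSucc_lt_last]
  · rintro ⟨h, hd⟩ a b c hab hbc h1 h2
    have hmax : ∀ x, ¬ insertMax p i i < insertMax p i x := fun x => by
      rw [insertMax_self]; exact (Fin.le_last _).not_gt
    obtain rfl | ⟨a, rfl⟩ := Fin.eq_self_or_eq_succAbove i a
    · exact hmax _ h1
    obtain rfl | ⟨b, rfl⟩ := Fin.eq_self_or_eq_succAbove i b
    · exact hmax _ h2
    rw [Fin.succAbove_lt_succAbove_iff] at hab
    rw [insertMax_succAbove, insertMax_succAbove, Fin.castSucc_lt_castSucc_iff] at h1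
    obtain rfl | ⟨c, rfl⟩ := Fin.eq_self_or_eq_succAbove i c
    · rw [Fin.succAbove_lt_iff_castSucc_lt] at hbc
      exact (hd a b hab (by simpa [Fin.lt_def] using hbc)).not_gt h1
    · rw [Fin.succAbove_lt_succAbove_iff] at hbc
      rw [insertMax_succAbove, insertMax_succAbove, Fin.castSucc_lt_castSucc_iff] at h2
      exact h a b c hab hbc h1 h2

theorem initialRun_insertMax_zero {n : ℕ} (p : Equiv.Perm (Fin n)) :
    initialRun (insertMax p 0) = initialRun p + 1 := by
  have key : ∀ j, DecreasingPrefix (insertMax p 0) (j + 1) ↔ DecreasingPrefix p j := by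
    intro j
    constructor
    · intro h a b hab hb
      have := h (Fin.succAbove 0 a) (Fin.succAbove 0 b) (by simpa using hab) (by simpa using hb)
      rwa [insertMax_succAbove, insertMax_succAbove, Fin.castSucc_lt_castSucc_iff] at this
    · intro h a b hab hb
      obtain rfl | ⟨b, rfl⟩ := Fin.eq_self_or_eq_succAbove 0 b
      · simp at hab
      obtain rfl | ⟨a, rfl⟩ := Fin.eq_self_or_eq_succAbove 0 a
      · simp only [insertMax_self, insertMax_succAbove, Fin.castSucc_lt_last]
      · simp only [insertMax_succAbove, Fin.castSucc_lt_castSucc_iff]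
        exact h a b (by simpa using hab) (by simpa using hb)
  refine initialRun_eq _ (by simpa using initialRun_le p) ?_ ?_
  · rw [key]; exact (le_initialRun_iff p (initialRun_le p)).1 le_rfl
  · intro hlt h
    rw [key, ← le_initialRun_iff p (by omega)] at h
    omega

/-- The maximum, not being first, is preceded by a smaller entry and ends the run there. -/
theorem initialRun_insertMax_of_ne_zero {n : ℕ} (p : Equiv.Perm (Fin n)) {i : Fin (n + 1)}
    (hi : i ≠ 0) (hle : (i : ℕ) ≤ initialRun p) : initialRun (insertMax p i) = i := by
  rw [le_initialRun_iff p (Nat.lt_succ_iff.1 i.2)] at hle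
  refine initialRun_eq _ i.2.le ?_ ?_
  · intro a b hab hb
    obtain rfl | ⟨b, rfl⟩ := Fin.eq_self_or_eq_succAbove i b
    · exact absurd hb (lt_irrefl _)
    obtain rfl | ⟨a, rfl⟩ := Fin.eq_self_or_eq_succAbove i a
    · exact absurd hb (not_lt.2 hab.le)
    · simp only [insertMax_succAbove, Fin.castSucc_lt_castSucc_iff]
      have hb' : i.succAbove b < i := hb
      rw [Fin.succAbove_lt_iff_castSucc_lt] at hb'
      exact hle a b (by simpa using hab) hb'
  · intro _ h
    have h0 : (0 : Fin (n + 1)) < i := Fin.pos_iff_ne_zero.2 hi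
    have := h 0 i h0 (Nat.lt_succ_self _)
    rw [insertMax_self] at this
    exact (Fin.le_last _).not_gt this

/-! ### Noninversions along the generating tree -/

/-- The noninversions of `p`: pairs of positions whose entries are increasing. -/
def noninversions {n : ℕ} (p : Equiv.Perm (Fin n)) : Finset (Fin n × Fin n) :=
  Finset.univ.filter fun x => x.1 < x.2 ∧ p x.1 < p x.2

theorem card_noninversions_insertMax_le {n : ℕ} (p : Equiv.Perm (Fin n)) (i : Fin (n + 1)) :
    (noninversions (insertMax p i)).card ≤ (noninversions p).card + i := by
  classical
  have hsub : noninversions (insertMax p i) ⊆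
      (noninversions p).image (Prod.map i.succAbove i.succAbove) ∪
        (Finset.Iio i).image (fun x => (x, i)) := by
    rintro ⟨x, y⟩ h
    simp only [noninversions, Finset.mem_filter, Finset.mem_univ, true_and] at h
    obtain ⟨hxy, hlt⟩ := h
    rw [Finset.mem_union, Finset.mem_image, Finset.mem_image]
    obtain rfl | ⟨y, rfl⟩ := Fin.eq_self_or_eq_succAbove i y
    · exact Or.inr ⟨x, Finset.mem_Iio.2 hxy, rfl⟩
    obtain rfl | ⟨x, rfl⟩ := Fin.eq_self_or_eq_succAbove i x
    · rw [insertMax_self] at hlt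
      exact absurd hlt (Fin.le_last _).not_gt
    · refine Or.inl ⟨(x, y), ?_, rfl⟩
      simpa [noninversions, insertMax_succAbove] using And.intro hxy hlt
  refine (Finset.card_le_card hsub).trans ((Finset.card_union_le _ _).trans ?_)
  refine add_le_add Finset.card_image_le (Finset.card_image_le.trans ?_)
  simp

/-- Each `123`-avoiding permutation of length `n + 1` arises once from one of length `n`, by
inserting a largest entry within or directly after the initial decreasing run. -/
theorem sum_avoiders_succ {n : ℕ} (h : Equiv.Perm (Fin (n + 1)) → ℚ) :
    ∑ σ ∈ avoiders (n + 1) pattern123, h σ =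
      ∑ p ∈ avoiders n pattern123, ∑ i : Fin (n + 1),
        if (i : ℕ) ≤ initialRun p then h (insertMax p i) else 0 := by
  classical
  have hs : ∀ (m : ℕ) (u : Equiv.Perm (Fin m) → ℚ), ∑ σ ∈ avoiders m pattern123, u σ =
      ∑ σ, if NoIncreasingTriple σ then u σ else 0 := by
    intro m u
    rw [← Finset.sum_filter]
    refine Finset.sum_congr ?_ fun _ _ => rfl
    ext p
    rw [mem_avoiders_pattern123]
    simp
  rw [hs, hs, ← (insertMax_bijective n).sum_comp, Fintype.sum_prod_type]
  refine Finset.sum_congr rfl fun p _ => ?_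
  by_cases hp : NoIncreasingTriple p
  · simp [noIncreasingTriple_insertMax, hp]
  · simp [noIncreasingTriple_insertMax, hp]

/-- In the generating tree of the `123`-avoiding permutations, labelled by the length of the initial
decreasing run, a permutation with label `s` has children with labels `1, …, s + 1`. -/
theorem sum_insertMax_initialRun {n : ℕ} (p : Equiv.Perm (Fin n)) (u : ℕ → ℚ) :
    (∑ i : Fin (n + 1),
      if (i : ℕ) ≤ initialRun p then u (initialRun (insertMax p i)) else 0) =
      ∑ t ∈ Finset.range (initialRun p + 1), u (t + 1) := by
  have h1 : ∀ i : Fin (n + 1),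
      (if (i : ℕ) ≤ initialRun p then u (initialRun (insertMax p i)) else 0) =
      (fun j : ℕ => if j ≤ initialRun p then u (if j = 0 then initialRun p + 1 else j) else 0) i := by
    intro i
    by_cases hi : (i : ℕ) ≤ initialRun p
    · by_cases h0 : i = 0
      · subst h0
        simp [initialRun_insertMax_zero]
      · have h0' : (i : ℕ) ≠ 0 := fun h => h0 (Fin.ext h)
        simp [hi, h0, initialRun_insertMax_of_ne_zero p h0 hi]
    · simp [hi]
  rw [Finset.sum_congr rfl fun i _ => h1 i, Fin.sum_univ_eq_sum_range
    (fun j : ℕ => if j ≤ initialRun p then u (if j = 0 then initialRun p + 1 else j) else 0),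
    ← Finset.sum_filter]
  have h2 : (Finset.range (n + 1)).filter (fun j => j ≤ initialRun p) =
      Finset.range (initialRun p + 1) := by
    have := initialRun_le p
    ext j
    simp only [Finset.mem_filter, Finset.mem_range]
    omega
  -- Position `0` gives the label `s + 1`, so the first term on the left matches the last on the
  -- right.
  rw [h2, Finset.sum_range_succ', Finset.sum_range_succ]
  simp

theorem card_avoiders_eq_sum_ballot (r m n : ℕ) (h : m + r = n) :
    ((avoiders n pattern123).card : ℚ) =
      ∑ p ∈ avoiders m pattern123, ballot r (initialRun p) := by
  induction r generalizing m with
  | zero => subst h; simp [ballot_zero]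
  | succ r ih =>
    rw [ih (m + 1) (by omega), sum_avoiders_succ]
    refine Finset.sum_congr rfl fun p _ => ?_
    rw [sum_insertMax_initialRun p (ballot r), sum_ballot]

theorem card_noninversions_insertMax_le_initialRun {n : ℕ} (p : Equiv.Perm (Fin n))
    {i : Fin (n + 1)} (hi : (i : ℕ) ≤ initialRun p) :
    (noninversions (insertMax p i)).card ≤
      (noninversions p).card + initialRun (insertMax p i) := by
  refine (card_noninversions_insertMax_le p i).trans (Nat.add_le_add_left ?_ _)
  by_cases h0 : i = 0
  · simp [h0]
  · rw [initialRun_insertMax_of_ne_zero p h0 hi]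

/-- Induction on the distance `r` to level `n`; at `m = 0` only the root remains. -/
theorem sum_noninversions_le_sum_ballot (L : ℚ) (hL : 0 ≤ L) (r m n : ℕ) (h : m + r = n) :
    L * ∑ p ∈ avoiders n pattern123, ((noninversions p).card : ℚ) ≤
      ∑ p ∈ avoiders m pattern123, ballot r (initialRun p) *
        (L * (noninversions p).card + squareBound r (initialRun p) + L ^ 2 * r) := by
  induction r generalizing m with
  | zero => subst h; simp [ballot_zero, squareBound, Finset.mul_sum]
  | succ r ih =>
    refine (ih (m + 1) (by omega)).trans ?_
    rw [sum_avoiders_succ]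
    refine Finset.sum_le_sum fun p _ => ?_
    set f : ℚ := ((noninversions p).card : ℚ) with hf
    let u : ℕ → ℚ := fun t => ballot r t * (L * f + L ^ 2 * (r + 1)) +
      ballot r t * ((t : ℚ) ^ 2 + squareBound r t)
    calc _ ≤ ∑ i : Fin (m + 1),
            if (i : ℕ) ≤ initialRun p then u (initialRun (insertMax p i)) else 0 := by
          refine Finset.sum_le_sum fun i _ => ?_
          split_ifs with hi
          · have h1 : ((noninversions (insertMax p i)).card : ℚ) ≤
                f + initialRun (insertMax p i) := by
              rw [hf]
              exact_mod_cast card_noninversions_insertMax_le_initialRun p hi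
            simp only [u, ← mul_add]
            refine mul_le_mul_of_nonneg_left ?_ (ballot_nonneg _ _)
            have h2 := mul_le_mul_of_nonneg_left h1 hL
            -- AM-GM for the label `t`: `L * t ≤ t ^ 2 + L ^ 2 / 4`.
            nlinarith [sq_nonneg (L - 2 * (initialRun (insertMax p i) : ℚ)), sq_nonneg L]
          · exact le_rfl
      _ = ∑ t ∈ Finset.range (initialRun p + 1), u (t + 1) := sum_insertMax_initialRun p u
      _ ≤ _ := by
          rw [Finset.sum_add_distrib, ← Finset.sum_mul, sum_ballot]
          have := sum_ballot_mul_le r (initialRun p)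
          push_cast at this ⊢
          linarith

theorem initialRun_eq_zero (p : Equiv.Perm (Fin 0)) : initialRun p = 0 :=
  Nat.le_zero.1 (initialRun_le p)

/-- A bound for the total number of noninversions of the `123`-avoiding permutations. -/
theorem sum_noninversions_le (L : ℚ) (hL : 0 ≤ L) (n : ℕ) :
    L * ∑ p ∈ avoiders n pattern123, ((noninversions p).card : ℚ) ≤
      (avoiders n pattern123).card * (3 * n ^ 2 + L ^ 2 * n) := by
  refine (sum_noninversions_le_sum_ballot L hL n 0 n (zero_add n)).trans_eq ?_
  rw [card_avoiders_eq_sum_ballot n 0 n (zero_add n), Finset.sum_mul]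
  refine Finset.sum_congr rfl fun p _ => ?_
  have : noninversions p = ∅ := Finset.eq_empty_of_isEmpty _
  rw [this, initialRun_eq_zero, squareBound]
  push_cast [Finset.card_empty]
  ring

theorem decreasingPerm_mem_avoiders (n : ℕ) : decreasingPerm n ∈ avoiders n pattern123 := by
  rw [mem_avoiders_pattern123]
  intro a b c hab _ h
  simp only [decreasingPerm, Fin.revPerm_apply, Fin.rev_lt_rev] at h
  exact absurd h hab.not_gt

/-! ### Selections of `k` positions -/

/-- The increasing position sequences at which the entries of `p` are not decreasing. -/
def nondecreasingSelections {n : ℕ} (k : ℕ) (p : Equiv.Perm (Fin n)) : Finset (Fin k → Fin n) :=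
  Finset.univ.filter fun f =>
    (∀ a b, a < b → f a < f b) ∧ ∃ a b, a < b ∧ p (f a) < p (f b)

theorem exists_lt_of_ne_decreasingPerm {k : ℕ} {q : Equiv.Perm (Fin k)}
    (hq : q ≠ decreasingPerm k) : ∃ a b, a < b ∧ q a < q b := by
  by_contra! h
  apply hq
  have hanti : StrictAnti q := fun a b hab => lt_of_le_of_ne (h a b hab) (q.injective.ne hab.ne')
  have hmono : StrictMono (Fin.rev ∘ q) := fun a b hab => by simpa using hanti hab
  -- A finite linear order has no order automorphism but the identity.
  have hid : Fin.rev ∘ q = id := by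
    have := Subsingleton.elim
      (StrictMono.orderIsoOfSurjective _ hmono (Fin.rev_surjective.comp q.surjective))
      (OrderIso.refl _)
    ext a
    exact congrArg (fun e : Fin k ≃o Fin k => (e a : ℕ)) this
  ext a
  have := congrFun hid a
  simp only [Function.comp_apply, id_eq] at this
  rw [decreasingPerm, Fin.revPerm_apply, ← Fin.rev_eq_iff.1 this]

theorem patternCount_le_card_nondecreasingSelections {k n : ℕ} {q : Equiv.Perm (Fin k)}
    (hq : q ≠ decreasingPerm k) (p : Equiv.Perm (Fin n)) :
    patternCount q p ≤ (nondecreasingSelections k p).card := by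
  refine Finset.card_le_card fun f hf => ?_
  simp only [nondecreasingSelections, Finset.mem_filter, Finset.mem_univ, true_and] at hf ⊢
  obtain ⟨a, b, hab, hlt⟩ := exists_lt_of_ne_decreasingPerm hq
  exact ⟨hf.1, a, b, hab, (hf.2 a b).1 hlt⟩

theorem choose_le_card_increasing (k n : ℕ) : n.choose k ≤
    (Finset.univ.filter fun f : Fin k → Fin n => ∀ a b, a < b → f a < f b).card := by
  classical
  have hc : (Finset.powersetCard k (Finset.univ : Finset (Fin n))).card = n.choose k := by simp
  rw [← hc]
  refine Finset.card_le_card_of_surjOn (fun f => Finset.univ.image f) ?_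
  intro s hs
  have hs' : s.card = k := (Finset.mem_powersetCard.1 hs).2
  refine ⟨s.orderEmbOfFin hs', ?_, ?_⟩
  · simp
  · simp

theorem choose_le_patternCount_add {k n : ℕ} (p : Equiv.Perm (Fin n)) :
    n.choose k ≤ patternCount (decreasingPerm k) p + (nondecreasingSelections k p).card := by
  classical
  refine (choose_le_card_increasing k n).trans (le_trans (Finset.card_le_card ?_)
    (Finset.card_union_le _ _))
  intro f hf
  simp only [Finset.mem_filter, Finset.mem_univ, true_and] at hf
  simp only [nondecreasingSelections, IsOccurrence, Finset.mem_union, Finset.mem_filter,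
    Finset.mem_univ, true_and]
  by_cases h : ∃ a b, a < b ∧ p (f a) < p (f b)
  · exact Or.inr ⟨hf, h⟩
  · push Not at h
    refine Or.inl ⟨hf, ?_⟩
    have hanti : StrictAnti fun a => p (f a) := fun a b hab =>
      lt_of_le_of_ne (h a b hab) (p.injective.ne (hf a b hab).ne')
    intro a b
    rw [hanti.lt_iff_gt]
    simp [decreasingPerm]

theorem card_filter_two_values_le {k n : ℕ} {a b : Fin k} (hab : a ≠ b) (i j : Fin n) :
    (Finset.univ.filter fun f : Fin k → Fin n => f a = i ∧ f b = j).card ≤ n ^ (k - 2) := by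
  classical
  have hcard : Fintype.card ({c : Fin k // c ∉ ({a, b} : Finset (Fin k))} → Fin n) = n ^ (k - 2) := by
    rw [Fintype.card_fun, Fintype.card_fin, Fintype.card_subtype_compl,
      Fintype.card_coe, Finset.card_pair hab, Fintype.card_fin]
  rw [← hcard, ← Finset.card_univ]
  refine Finset.card_le_card_of_injOn (fun f c => f c) (fun _ _ => Finset.mem_univ _) ?_
  intro f hf g hg hfg
  simp only [Finset.coe_filter, Finset.mem_univ, true_and, Set.mem_ofPred_eq] at hf hg
  funext c
  by_cases hc : c ∈ ({a, b} : Finset (Fin k))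
  · simp only [Finset.mem_insert, Finset.mem_singleton] at hc
    rcases hc with rfl | rfl
    · rw [hf.1, hg.1]
    · rw [hf.2, hg.2]
  · exact congrFun hfg ⟨c, hc⟩

/-- Union bound over a pair of indices and the noninversion it hits. -/
theorem card_nondecreasingSelections_le {n : ℕ} (k : ℕ) (p : Equiv.Perm (Fin n)) :
    (nondecreasingSelections k p).card ≤ k ^ 2 * n ^ (k - 2) * (noninversions p).card := by
  classical
  let T : Finset ((Fin k × Fin k) × (Fin n × Fin n)) :=
    (Finset.univ.filter fun x : Fin k × Fin k => x.1 ≠ x.2) ×ˢ noninversions p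
  have hsub : nondecreasingSelections k p ⊆ T.biUnion fun x =>
      Finset.univ.filter fun f : Fin k → Fin n => f x.1.1 = x.2.1 ∧ f x.1.2 = x.2.2 := by
    intro f hf
    simp only [nondecreasingSelections, Finset.mem_filter, Finset.mem_univ, true_and] at hf
    obtain ⟨hf, a, b, hab, hlt⟩ := hf
    rw [Finset.mem_biUnion]
    refine ⟨((a, b), (f a, f b)), ?_, ?_⟩
    · simp [T, noninversions, hab.ne, hf a b hab, hlt]
    · simp
  refine (Finset.card_le_card hsub).trans ?_
  refine (Finset.card_biUnion_le_card_mul _ _ (n ^ (k - 2)) ?_).trans ?_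
  · intro x hx
    simp only [T, Finset.mem_product, Finset.mem_filter, Finset.mem_univ, true_and] at hx
    exact card_filter_two_values_le hx.1 _ _
  · have h1 : (Finset.univ.filter fun x : Fin k × Fin k => x.1 ≠ x.2).card ≤ k ^ 2 :=
      (Finset.card_le_univ _).trans (by simp [sq])
    rw [Finset.card_product]
    calc _ ≤ k ^ 2 * (noninversions p).card * n ^ (k - 2) := by gcongr
      _ = _ := by ring

theorem pow_le_choose_mul {k n : ℕ} (h : 2 * k ≤ n) :
    n ^ k ≤ 2 ^ k * k.factorial * n.choose k := by
  have h1 := Nat.pow_sub_le_descFactorial n k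
  rw [Nat.descFactorial_eq_factorial_mul_choose] at h1
  calc n ^ k ≤ (2 * (n + 1 - k)) ^ k := Nat.pow_le_pow_left (by omega) k
    _ = 2 ^ k * (n + 1 - k) ^ k := mul_pow _ _ _
    _ ≤ 2 ^ k * (k.factorial * n.choose k) := Nat.mul_le_mul_left _ h1
    _ = _ := by ring

/-! ### Comparison of the totals -/

/-- The mean number of noninversions of a `123`-avoiding permutation is subquadratic. -/
theorem mul_sum_noninversions_lt (D n : ℕ) (hD : 0 < D) (hn : 12 * D ^ 2 < n) :
    D * ∑ p ∈ avoiders n pattern123, (noninversions p).card <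
      (avoiders n pattern123).card * n ^ 2 := by
  have hA : 0 < (avoiders n pattern123).card :=
    Finset.card_pos.2 ⟨_, decreasingPerm_mem_avoiders n⟩
  have hn0 : 0 < n := by omega
  -- This `L` makes the `L ^ 2` term cost exactly half of `n ^ 2` after rescaling; `12 * D ^ 2 < n`
  -- keeps the rest below the other half.
  have h := sum_noninversions_le ((n : ℚ) / (2 * D)) (by positivity) n
  have hD' : (0 : ℚ) < D := by exact_mod_cast hD
  have hnq : (0 : ℚ) < n := by exact_mod_cast hn0
  have hAq : (0 : ℚ) < (avoiders n pattern123).card := by exact_mod_cast hA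
  have hn' : (12 : ℚ) * D ^ 2 < n := by exact_mod_cast hn
  rw [← Nat.cast_lt (α := ℚ)]
  push_cast
  set F : ℚ := ∑ p ∈ avoiders n pattern123, ((noninversions p).card : ℚ)
  set A : ℚ := ((avoiders n pattern123).card : ℚ)
  have h1 : D * F ≤ A * (6 * D ^ 2 * n + n ^ 2 / 2) := by
    have h2 := mul_le_mul_of_nonneg_left h (by positivity : (0 : ℚ) ≤ 2 * D ^ 2 / n)
    calc D * F = 2 * D ^ 2 / n * (n / (2 * D) * F) := by field_simp
      _ ≤ _ := h2
      _ = _ := by field_simp; ring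
  refine h1.trans_lt (mul_lt_mul_of_pos_left ?_ hAq)
  nlinarith

theorem mainTheorem9 (k : ℕ) (hk : 0 < k) (q : Equiv.Perm (Fin k))
    (hq : q ≠ decreasingPerm k) :
    ∃ N : ℕ, ∀ n : ℕ, N ≤ n →
      totalCount (decreasingPerm k) (avoiders n pattern123) >
        totalCount q (avoiders n pattern123) := by
  have hk2 : 2 ≤ k := by
    obtain ⟨a, b, hab, -⟩ := exists_lt_of_ne_decreasingPerm hq
    have := b.2
    have : (a : ℕ) < b := hab
    omega
  -- `D` collects the factors lost in `h3` and `h5` and the `2` of `h6`.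
  set D := 2 * k ^ 2 * (2 ^ k * k.factorial) with hD
  have hDpos : 0 < D := by positivity
  refine ⟨12 * D ^ 2 + 1 + 2 * k, fun n hn => ?_⟩
  set C := avoiders n pattern123 with hC
  set S := ∑ p ∈ C, (nondecreasingSelections k p).card with hS
  have h1 : totalCount q C ≤ S :=
    Finset.sum_le_sum fun p _ => patternCount_le_card_nondecreasingSelections hq p
  have h2 : C.card * n.choose k ≤ totalCount (decreasingPerm k) C + S := by
    rw [totalCount, hS, ← Finset.sum_add_distrib, ← smul_eq_mul, ← Finset.sum_const]
    exact Finset.sum_le_sum fun p _ => choose_le_patternCount_add p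
  have h3 : S ≤ k ^ 2 * n ^ (k - 2) * ∑ p ∈ C, (noninversions p).card := by
    rw [Finset.mul_sum]
    exact Finset.sum_le_sum fun p _ => card_nondecreasingSelections_le k p
  have h4 := mul_sum_noninversions_lt D n hDpos (by omega)
  have h5 := pow_le_choose_mul (k := k) (n := n) (by omega)
  have hnpos : 0 < n := by omega
  -- The factor 2 leaves more than `S` decreasing selections, while `q` has at most `S` occurrences.
  have h6 : 2 * S < C.card * n.choose k := by
    refine Nat.lt_of_mul_lt_mul_left (a := 2 ^ k * k.factorial) ?_
    calc 2 ^ k * k.factorial * (2 * S)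
        ≤ 2 ^ k * k.factorial *
          (2 * (k ^ 2 * n ^ (k - 2) * ∑ p ∈ C, (noninversions p).card)) := by gcongr
      _ = n ^ (k - 2) * (D * ∑ p ∈ C, (noninversions p).card) := by rw [hD]; ring
      _ < n ^ (k - 2) * (C.card * n ^ 2) := Nat.mul_lt_mul_of_pos_left h4 (by positivity)
      _ = C.card * n ^ k := by
          conv_rhs => rw [← Nat.sub_add_cancel hk2, pow_add]
          ring
      _ ≤ C.card * (2 ^ k * k.factorial * n.choose k) := by gcongr
      _ = _ := by ring
  omega
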